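/- Let $d\ge 1$. For an integer $r\ge 1$ let $L_r(t)=\sum_{k=0}^{r-1}(-1)^k\binom{r-1}{k}^2t^{r-1-k}(1-t)^k$ be the shifted Legendre polynomial of degree $r-1$, and for a multi-index $\alpha=(i_1,\dots,i_d)$ of integers $i_k\ge 1$ put $L_\alpha(t_1,\dots,t_d)=\prod_{k=1}^d L_{i_k}(t_k)$. For a probability measure $\nu$ on $\mathbb{R}^d$, a monotone transport from the uniform law on $[0,1]^d$ onto $\nu$ is a gradient $\nabla\varphi$ of a real function $\varphi$ that is convex on $(0,1)^d$ (the gradient then exists almost everywhere) such that the push-forward of the uniform law on $[0,1]^d$ under $\nabla\varphi$ is $\nu$. Let $X$ be a random vector in $\mathbb{R}^d$ with $\mathbb{E}\|X\|<\infty$, let $\nabla\varphi$, with $\varphi$ convex, be a monotone transport from the uniform law on $[0,1]^d$ onto the law of $X$, and let $$\lambda_\alpha(X)=\int_{[0,1]^d}\nabla\varphi(t)\,L_\alpha(t)\,dt$$ be the associated L-moments. Let $m\in\mathbb{R}^d$ and $\sigma>0$. Then for every multi-index $\alpha$ the integral $\lambda_\alpha(X)$ converges absolutely, the law of $m+\sigma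 X$ also admits a monotone transport $\nabla\psi$ from the uniform law on $[0,1]^d$, and for every such transport the integral $\lambda_\alpha(m+\sigma X)=\int_{[0,1]^d}\nabla\psi(t)L_\alpha(t)\,dt$ converges absolutely and $$\lambda_\alpha(m+\sigma X)=\sigma\,\lambda_\alpha(X)+m\,\mathbf{1}_{\alpha=(1,\dots,1)}.$$ In particular (taking $m=0$, $\sigma=1$) the L-moments depend only on the law of $X$, not on the choice of the potential. -/

import Mathlib

open MeasureTheory Set
open scoped Gradient

noncomputable section

namespace MultivariateLMoments

/-- The closed unit cube `[0,1]^d`. -/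
def unitCube (d : ℕ) : Set (EuclideanSpace ℝ (Fin d)) :=
  {t | ∀ i, t i ∈ Icc (0 : ℝ) 1}

/-- The open unit cube `(0,1)^d`. -/
def openUnitCube (d : ℕ) : Set (EuclideanSpace ℝ (Fin d)) :=
  {t | ∀ i, t i ∈ Ioo (0 : ℝ) 1}

/-- The uniform law on `[0,1]^d`: Lebesgue measure restricted to the unit cube. -/
def unif (d : ℕ) : Measure (EuclideanSpace ℝ (Fin d)) :=
  volume.restrict (unitCube d)

/-- The shifted Legendre polynomial `L_r`, `r ≥ 1` (of degree `r - 1`, normalised by `L_r 1 = 1`):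
`L_r(t) = ∑_{k=0}^{r-1} (-1)^k (r-1 choose k)^2 t^{r-1-k} (1-t)^k`. -/
def legendre (r : ℕ) (t : ℝ) : ℝ :=
  ∑ k ∈ Finset.range r,
    (-1 : ℝ) ^ k * ((r - 1).choose k : ℝ) ^ 2 * t ^ (r - 1 - k) * (1 - t) ^ k

/-- The multivariate Legendre polynomial `L_α(t) = ∏ i, L_{α i}(t i)`. -/
def multiLegendre {d : ℕ} (α : Fin d → ℕ) (t : EuclideanSpace ℝ (Fin d)) : ℝ :=
  ∏ i, legendre (α i) (t i)

/-- `Q` is a transport map from the uniform law on `[0,1]^d` onto `ν`. -/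
def IsTransport {d : ℕ} (Q : EuclideanSpace ℝ (Fin d) → EuclideanSpace ℝ (Fin d))
    (ν : Measure (EuclideanSpace ℝ (Fin d))) : Prop :=
  Measurable Q ∧ (unif d).map Q = ν

/-- `φ` is a convex potential whose gradient is the monotone transport from the uniform law on
`[0,1]^d` onto `ν`. Finiteness and convexity are asked in the open cube only, because a convex
potential may be infinite on the boundary, which is a null set. A convex function is
differentiable almost everywhere in the open cube, so the default value of the gradient at points
of non-differentiability does not matter. -/
def IsConvexPotential {d : ℕ} (φ : EuclideanSpace ℝ (Fin d) → ℝ)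
    (ν : Measure (EuclideanSpace ℝ (Fin d))) : Prop :=
  ConvexOn ℝ (openUnitCube d) φ ∧ IsTransport (∇ φ) ν

/-- The L-moment of multi-index `α` associated to the transport `Q`:
`∫_{[0,1]^d} Q(t) L_α(t) dt`. -/
def lMoment {d : ℕ} (Q : EuclideanSpace ℝ (Fin d) → EuclideanSpace ℝ (Fin d))
    (α : Fin d → ℕ) : EuclideanSpace ℝ (Fin d) :=
  ∫ t, multiLegendre α t • Q t ∂(unif d)

/-- The defining integral of the L-moment of multi-index `α` associated to `Q` converges. -/
def LMomentExists {d : ℕ} (Q : EuclideanSpace ℝ (Fin d) → EuclideanSpace ℝ (Fin d))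
    (α : Fin d → ℕ) : Prop :=
  Integrable (fun t => multiLegendre α t • Q t) (unif d)

end MultivariateLMoments

end

/-! For one transport the formula is immediate: `⟪m, t⟫ + σ * φ t` is convex with gradient `m + σ •
∇ φ` almost everywhere, and `L_α` integrates to 1 or 0 according to whether `α = (1, …, 1)`. The
substance is that every convex potential for the same law has almost everywhere the same gradient
(`gradient_ae_eq_of_map_eq`).

Since the cube is bounded, a finite first moment makes both `⟪x, ∇ φ x⟫` and `φ` integrable, so a
duality argument applies. With `c` the convex conjugate of `φ`, Young's inequality `⟪x, p⟫ ≤ φ x + c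
p` is an equality at `p = ∇ φ x`. Integrated along a map `Q` with the same law as `∇ φ`, it shows
that `∇ φ` maximises `∫ ⟪x, Q x⟫` (`exists_correlation_defect`). Two convex gradients with the same
law therefore have equal correlations, the Young gap vanishes almost everywhere, and one gradient is
a subgradient of the other potential. Where that potential is differentiable, its only subgradient
is its gradient. -/

namespace MultivariateLMoments

open Filter Topology
open scoped RealInnerProductSpace

/-! ### Subgradients of convex functions -/

section ConvexGradient

variable {E : Type*} [NormedAddCommGroup E] [InnerProductSpace ℝ E] [CompleteSpace E]

/-- A convex function lies above its tangent hyperplanes. -/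
theorem ConvexOn.add_inner_gradient_le {U : Set E} {φ : E → ℝ} (hφ : ConvexOn ℝ U φ) {x y : E}
    (hx : x ∈ U) (hy : y ∈ U) (hd : DifferentiableAt ℝ φ x) :
    φ x + ⟪y - x, ∇ φ x⟫ ≤ φ y := by
  have hline : ∀ s : ℝ, AffineMap.lineMap x y s = x + s • (y - x) := fun s => by
    simp [AffineMap.lineMap_apply, add_comm]
  have hconv : ConvexOn ℝ (AffineMap.lineMap x y ⁻¹' U) (φ ∘ AffineMap.lineMap x y) :=
    hφ.comp_affineMap (AffineMap.lineMap x y : ℝ →ᵃ[ℝ] E)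
  have hder : HasDerivAt (φ ∘ AffineMap.lineMap x y) (fderiv ℝ φ x (y - x)) (0 : ℝ) := by
    have h1 : HasDerivAt (AffineMap.lineMap x y : ℝ → E) (y - x) 0 :=
      AffineMap.hasDerivAt_lineMap
    have h2 : HasFDerivAt φ (fderiv ℝ φ x) (AffineMap.lineMap x y (0 : ℝ)) := by
      simpa using hd.hasFDerivAt
    exact h2.comp_hasDerivAt 0 h1
  have h := hconv.le_slope_of_hasDerivAt (x := 0) (y := 1) (by simpa using hx)
    (by simpa using hy) one_pos hder
  have h3 : ⟪y - x, ∇ φ x⟫ = fderiv ℝ φ x (y - x) := by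
    simp [inner_gradient_right]
  simp only [slope, sub_zero, inv_one, Function.comp_apply, AffineMap.lineMap_apply_one,
    AffineMap.lineMap_apply_zero, vsub_eq_sub, one_smul] at h
  linarith

/-- At a point of differentiability the gradient is the only subgradient. -/
theorem gradient_eq_of_forall_inner_sub_le {U : Set E} (hU : IsOpen U) {φ : E → ℝ} {x p : E}
    (hx : x ∈ U) (hd : DifferentiableAt ℝ φ x)
    (h : ∀ y ∈ U, ⟪y, p⟫ - φ y ≤ ⟪x, p⟫ - φ x) : ∇ φ x = p := by
  have hmin : IsLocalMin (fun y => φ y - ⟪p, y⟫) x := by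
    filter_upwards [hU.mem_nhds hx] with y hy
    have := h y hy
    rw [real_inner_comm, real_inner_comm p x] at this
    linarith
  have hder : HasFDerivAt (fun y => φ y - ⟪p, y⟫) (fderiv ℝ φ x - innerSL ℝ p) x :=
    hd.hasFDerivAt.sub (innerSL ℝ p).hasFDerivAt
  have h0 := hmin.hasFDerivAt_eq_zero hder
  refine ext_inner_right ℝ fun v => ?_
  have := congrArg (fun L => L v) h0
  simp only [sub_apply, innerSL_apply_apply,
    zero_apply] at this
  rw [inner_gradient_left]
  linarith

theorem measurable_gradient [MeasurableSpace E] [BorelSpace E] (φ : E → ℝ) :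
    Measurable (∇ φ) :=
  ((InnerProductSpace.toDual ℝ E).symm.continuous.measurable).comp (measurable_fderiv ℝ φ)

end ConvexGradient

/-! ### Uniqueness of the monotone transport -/

section Uniqueness

variable {E : Type*} [NormedAddCommGroup E] [InnerProductSpace ℝ E] [FiniteDimensional ℝ E]
  [MeasurableSpace E] [BorelSpace E]

/-- A convex function on an open set is differentiable almost everywhere. -/
theorem ConvexOn.ae_differentiableAt {μ : Measure E} [μ.IsAddHaarMeasure] {U : Set E}
    (hU : IsOpen U) {φ : E → ℝ} (hφ : ConvexOn ℝ U φ) :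
    ∀ᵐ x ∂μ.restrict U, DifferentiableAt ℝ φ x := by
  rw [ae_restrict_iff' hU.measurableSet, ae_iff]
  refine measure_null_of_locally_null _ fun x hx => ?_
  simp only [Classical.not_imp, mem_ofPred_eq] at hx
  -- A convex function is locally Lipschitz, so Rademacher's theorem applies near each point.
  obtain ⟨K, t, ht, hK⟩ := hφ.locallyLipschitzOn hU hx.1
  rw [hU.nhdsWithin_eq hx.1] at ht
  refine ⟨_, inter_mem_nhdsWithin _ (interior_mem_nhds.2 ht), ?_⟩
  have := (hK.mono interior_subset).ae_differentiableWithinAt_of_mem (μ := μ)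
  rw [ae_iff] at this
  refine measure_mono_null ?_ this
  rintro y ⟨hy, hyt⟩
  simp only [Classical.not_imp, mem_ofPred_eq] at hy ⊢
  exact ⟨hyt, fun h => hy.2 (h.differentiableAt (isOpen_interior.mem_nhds hyt))⟩

theorem integrable_inner_of_isBounded {μ : Measure E} {U : Set E} (hU : IsOpen U) (hb : Bornology.IsBounded U) {Q : E → E}
    (hQ : Integrable Q (μ.restrict U)) : Integrable (fun x => ⟪x, Q x⟫) (μ.restrict U) := by
  obtain ⟨R, hR⟩ := hb.exists_norm_le
  refine (hQ.norm.const_mul R).mono' (aestronglyMeasurable_id.inner hQ.1) ?_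
  filter_upwards [ae_restrict_mem hU.measurableSet] with x hx
  exact (norm_inner_le_norm _ _).trans
    (mul_le_mul_of_nonneg_right (hR x hx) (norm_nonneg _))

variable {μ : Measure E} [μ.IsAddHaarMeasure] {U : Set E}

/-- The tangent at a fixed `x₀` bounds `φ` from below; the tangent at `x`, evaluated at `x₀`, bounds
`φ x` from above. Both bounds are integrable. -/
theorem ConvexOn.integrable_of_integrable_gradient (hU : IsOpen U) (hne : U.Nonempty)
    (hb : Bornology.IsBounded U) {φ : E → ℝ} (hφ : ConvexOn ℝ U φ)
    (hint : Integrable (∇ φ) (μ.restrict U)) : Integrable φ (μ.restrict U) := by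
  have hd := ConvexOn.ae_differentiableAt (μ := μ) hU hφ
  have hmem : ∀ᵐ x ∂μ.restrict U, x ∈ U := ae_restrict_mem hU.measurableSet
  have : NeBot (ae (μ.restrict U)) := by
    rw [ae_neBot, Ne, Measure.restrict_eq_zero]
    exact (hU.measure_pos μ hne).ne'
  obtain ⟨x₀, hx₀, hd₀⟩ := (hmem.and hd).exists
  have : IsFiniteMeasure (μ.restrict U) := ⟨by simpa using hb.measure_lt_top⟩
  obtain ⟨R, hR⟩ := hb.exists_norm_le
  have hid : Integrable (fun x : E => x) (μ.restrict U) := by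
    refine Integrable.of_bound aestronglyMeasurable_id R ?_
    filter_upwards [hmem] with x hx using hR x hx
  refine integrable_of_le_of_le (g₁ := fun x => φ x₀ + ⟪x - x₀, ∇ φ x₀⟫)
    (g₂ := fun x => φ x₀ - (⟪x₀, ∇ φ x⟫ - ⟪x, ∇ φ x⟫))
    ((hφ.continuousOn hU).aestronglyMeasurable hU.measurableSet) ?_ ?_ ?_ ?_
  · filter_upwards [hmem] with x hx using ConvexOn.add_inner_gradient_le hφ hx₀ hx hd₀
  · filter_upwards [hmem, hd] with x hx hdx
    have := ConvexOn.add_inner_gradient_le hφ hx hx₀ hdx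
    rw [inner_sub_left] at this
    linarith
  · exact (integrable_const _).add ((hid.sub (integrable_const _)).inner_const _)
  · exact (integrable_const _).sub
      ((hint.const_inner _).sub (integrable_inner_of_isBounded hU hb hint))

/-- Rearrangement inequality: among all maps with the same law, the gradient of a convex function
maximises the correlation with the identity. The defect `g` is nonnegative, and vanishes only
where the two maps agree. -/
theorem exists_correlation_defect (hU : IsOpen U) (hne : U.Nonempty)
    (hb : Bornology.IsBounded U) {φ : E → ℝ} (hφ : ConvexOn ℝ U φ)
    (hint : Integrable (∇ φ) (μ.restrict U)) {Q : E → E} (hQ : Measurable Q)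
    (hmap : (μ.restrict U).map Q = (μ.restrict U).map (∇ φ)) :
    ∃ g : E → ℝ, Integrable g (μ.restrict U) ∧ (∀ᵐ x ∂μ.restrict U, 0 ≤ g x) ∧
      ∫ x, g x ∂μ.restrict U =
        ∫ x, ⟪x, ∇ φ x⟫ ∂μ.restrict U - ∫ x, ⟪x, Q x⟫ ∂μ.restrict U ∧
      ∀ᵐ x ∂μ.restrict U, g x = 0 → ∇ φ x = Q x := by
  have : Nonempty U := hne.to_subtype
  have hd := ConvexOn.ae_differentiableAt (μ := μ) hU hφ
  have hmem : ∀ᵐ x ∂μ.restrict U, x ∈ U := ae_restrict_mem hU.measurableSet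
  have hG : Measurable (∇ φ) := measurable_gradient φ
  let u : ℕ → U := TopologicalSpace.denseSeq U
  let a : ℕ → E → ℝ := fun n p => ⟪(u n : E), p⟫ - φ (u n)
  -- The convex conjugate of `φ`, taken over a dense sequence so that it is measurable.
  let c : E → ℝ := fun p => ⨆ n, a n p
  have ha : ∀ n, Measurable (a n) := fun n => by
    simp only [a]
    fun_prop
  have hc : Measurable c := Measurable.iSup ha
  -- Outside `B` the real supremum takes a default value and Young's inequality may fail.
  let B : Set E := {p | BddAbove (range fun n => a n p)}
  have hB : MeasurableSet B := measurableSet_bddAbove_range ha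
  have young : ∀ p ∈ B, ∀ x ∈ U, ⟪x, p⟫ - φ x ≤ c p := by
    intro p hp x hx
    have hcont : Continuous fun y : U => ⟪(y : E), p⟫ - φ y :=
      (continuous_subtype_val.inner continuous_const).sub
        (continuousOn_iff_continuous_domRestrict.1 (hφ.continuousOn hU))
    exact (TopologicalSpace.denseRange_denseSeq U).induction_on
      (p := fun y : U => ⟪(y : E), p⟫ - φ y ≤ c p) ⟨x, hx⟩
      (isClosed_le hcont continuous_const) fun n => le_ciSup hp n
  have hbound : ∀ x ∈ U, DifferentiableAt ℝ φ x →
      ∀ n, a n (∇ φ x) ≤ ⟪x, ∇ φ x⟫ - φ x := by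
    intro x hx hdx n
    have := ConvexOn.add_inner_gradient_le hφ hx (u n).2 hdx
    rw [inner_sub_left] at this
    simp only [a]
    linarith
  have hcG : ∀ᵐ x ∂μ.restrict U, ∇ φ x ∈ B ∧ c (∇ φ x) = ⟪x, ∇ φ x⟫ - φ x := by
    filter_upwards [hmem, hd] with x hx hdx
    have hxB : ∇ φ x ∈ B := ⟨_, forall_mem_range.2 (hbound x hx hdx)⟩
    exact ⟨hxB, le_antisymm (ciSup_le (hbound x hx hdx)) (young _ hxB x hx)⟩
  -- Membership in `B` depends only on the law, so it passes from `∇ φ` to `Q`.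
  have hBQ : ∀ᵐ x ∂μ.restrict U, Q x ∈ B := by
    have : ∀ᵐ p ∂(μ.restrict U).map (∇ φ), p ∈ B :=
      (ae_map_iff hG.aemeasurable hB).2 (hcG.mono fun x hx => hx.1)
    rw [← hmap] at this
    exact (ae_map_iff hQ.aemeasurable hB).1 this
  have hφi := ConvexOn.integrable_of_integrable_gradient hU hne hb hφ hint
  have hQi : Integrable Q (μ.restrict U) := by
    have : Integrable id ((μ.restrict U).map (∇ φ)) :=
      (integrable_map_measure aestronglyMeasurable_id hG.aemeasurable).2 hint
    rw [← hmap] at this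
    exact (integrable_map_measure aestronglyMeasurable_id hQ.aemeasurable).1 this
  have hGx := integrable_inner_of_isBounded hU hb hint
  have hQx := integrable_inner_of_isBounded hU hb hQi
  have hcGi : Integrable (fun x => c (∇ φ x)) (μ.restrict U) :=
    (hGx.sub hφi).congr (hcG.mono fun x hx => hx.2.symm)
  have hcQi : Integrable (fun x => c (Q x)) (μ.restrict U) := by
    have : Integrable c ((μ.restrict U).map (∇ φ)) :=
      (integrable_map_measure hc.aestronglyMeasurable hG.aemeasurable).2 hcGi
    rw [← hmap] at this
    exact (integrable_map_measure hc.aestronglyMeasurable hQ.aemeasurable).1 this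
  have hcint : ∫ x, c (Q x) ∂μ.restrict U = ∫ x, c (∇ φ x) ∂μ.restrict U := by
    rw [← integral_map hQ.aemeasurable hc.aestronglyMeasurable,
      ← integral_map hG.aemeasurable hc.aestronglyMeasurable, hmap]
  -- The defect is the gap in Young's inequality at `(x, Q x)`. Where it vanishes, `Q x` is a
  -- subgradient of `φ` at `x`.
  refine ⟨fun x => φ x + c (Q x) - ⟪x, Q x⟫, (hφi.add hcQi).sub hQx, ?_, ?_, ?_⟩
  · filter_upwards [hmem, hBQ] with x hx hxB
    linarith [young _ hxB x hx]
  · have h1 : ∫ x, φ x + c (Q x) - ⟪x, Q x⟫ ∂μ.restrict U =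
        ∫ x, φ x + c (Q x) ∂μ.restrict U - ∫ x, ⟪x, Q x⟫ ∂μ.restrict U :=
      integral_sub (hφi.add hcQi) hQx
    rw [h1, integral_add hφi hcQi, hcint,
      integral_congr_ae (hcG.mono fun x hx => hx.2), integral_sub hGx hφi]
    ring
  · filter_upwards [hmem, hd, hBQ] with x hx hdx hxB h0
    refine gradient_eq_of_forall_inner_sub_le hU hx hdx fun y hy => ?_
    linarith [young _ hxB y hy]

/-- Uniqueness of the monotone transport from a bounded open set, when the target has a finite
first moment. -/
theorem gradient_ae_eq_of_map_eq (hU : IsOpen U) (hne : U.Nonempty)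
    (hb : Bornology.IsBounded U) {φ ψ : E → ℝ} (hφ : ConvexOn ℝ U φ) (hψ : ConvexOn ℝ U ψ)
    (hφi : Integrable (∇ φ) (μ.restrict U)) (hψi : Integrable (∇ ψ) (μ.restrict U))
    (hmap : (μ.restrict U).map (∇ φ) = (μ.restrict U).map (∇ ψ)) :
    ∇ φ =ᵐ[μ.restrict U] ∇ ψ := by
  obtain ⟨g, hgi, hg0, hg, hgeq⟩ :=
    exists_correlation_defect hU hne hb hφ hφi (measurable_gradient ψ) hmap.symm
  obtain ⟨k, -, hk0, hk, -⟩ :=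
    exists_correlation_defect hU hne hb hψ hψi (measurable_gradient φ) hmap
  -- The two integrated defects are nonnegative and opposite to each other.
  have hgz : ∫ x, g x ∂μ.restrict U = 0 := by
    linarith [integral_nonneg_of_ae hg0, integral_nonneg_of_ae hk0]
  filter_upwards [(integral_eq_zero_iff_of_nonneg_ae hg0 hgi).1 hgz, hgeq] with x h1 h2
  exact h2 h1

end Uniqueness

/-! ### Integrals of the shifted Legendre polynomials -/

section Legendre

theorem continuous_legendre (r : ℕ) : Continuous (legendre r) := by
  unfold legendre
  fun_prop

theorem continuous_multiLegendre {d : ℕ} (α : Fin d → ℕ) : Continuous (multiLegendre α) :=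
  continuous_finsetProd _ fun i _ => (continuous_legendre (α i)).comp (by fun_prop)

/-- The Beta integral at integers: integration by parts lowers `b` and raises `a`, keeping `a + b`
fixed. -/
theorem choose_mul_integral_pow_mul_one_sub_pow (b a : ℕ) :
    ((a + b).choose b : ℝ) * (a + b + 1) * ∫ t in (0 : ℝ)..1, t ^ a * (1 - t) ^ b = 1 := by
  induction b generalizing a with
  | zero =>
    simp only [pow_zero, mul_one, integral_pow]
    have : (a : ℝ) + 1 ≠ 0 := by positivity
    simp [this]
  | succ b ih =>
    have hparts : (a + 1 : ℝ) * ∫ t in (0 : ℝ)..1, t ^ a * (1 - t) ^ (b + 1) =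
        (b + 1) * ∫ t in (0 : ℝ)..1, t ^ (a + 1) * (1 - t) ^ b := by
      have hder : ∀ t ∈ uIcc (0 : ℝ) 1, HasDerivAt (fun t : ℝ => t ^ (a + 1) * (1 - t) ^ (b + 1))
          ((a + 1) * (t ^ a * (1 - t) ^ (b + 1)) - (b + 1) * (t ^ (a + 1) * (1 - t) ^ b)) t := by
        intro t _
        have h1 := (hasDerivAt_pow (a + 1) t).mul
          ((((hasDerivAt_id t).const_sub 1).pow (b + 1)))
        convert! h1 using 1
        simp
        ring
      have hftc := intervalIntegral.integral_eq_sub_of_hasDerivAt hder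
        (Continuous.intervalIntegrable (by fun_prop) _ _)
      rw [intervalIntegral.integral_sub (Continuous.intervalIntegrable (by fun_prop) _ _)
        (Continuous.intervalIntegrable (by fun_prop) _ _), intervalIntegral.integral_const_mul,
        intervalIntegral.integral_const_mul] at hftc
      simp at hftc
      linarith
    have hchoose : ((a + 1 + b).choose (b + 1) : ℝ) * (b + 1) =
        ((a + 1 + b).choose b : ℝ) * (a + 1) := by
      have := Nat.choose_succ_right_eq (a + 1 + b) b
      rw [Nat.add_sub_cancel] at this
      exact_mod_cast this
    have := ih (a + 1)
    rw [show a + (b + 1) = a + 1 + b by ring]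
    have hb : (b + 1 : ℝ) ≠ 0 := by positivity
    refine mul_left_cancel₀ hb ?_
    push_cast at this ⊢
    linear_combination (a + 1 + b + 1 : ℝ) * (∫ t in (0 : ℝ)..1, t ^ a * (1 - t) ^ (b + 1)) *
      hchoose + ((a + 1 + b).choose b : ℝ) * (a + 1 + b + 1) * hparts + (b + 1 : ℝ) * this

/-- The shifted Legendre polynomials of positive degree have integral zero. -/
theorem integral_legendre {r : ℕ} (hr : 1 ≤ r) :
    ∫ t in (0 : ℝ)..1, legendre r t = if r = 1 then 1 else 0 := by
  obtain ⟨n, rfl⟩ := Nat.exists_eq_add_of_le' hr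
  simp only [legendre, Nat.add_sub_cancel]
  rw [intervalIntegral.integral_finsetSum fun k _ =>
    Continuous.intervalIntegrable (by fun_prop) _ _]
  -- The Beta integral cancels one binomial factor, leaving an alternating sum of binomial
  -- coefficients.
  have hterm : ∀ k ∈ Finset.range (n + 1),
      (∫ t in (0 : ℝ)..1, (-1 : ℝ) ^ k * (n.choose k : ℝ) ^ 2 * t ^ (n - k) * (1 - t) ^ k) =
        ((-1 : ℝ) ^ k * (n.choose k : ℝ)) * (n + 1 : ℝ)⁻¹ := by
    intro k hk
    have hkn : k ≤ n := Nat.lt_succ_iff.1 (Finset.mem_range.1 hk)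
    have h := choose_mul_integral_pow_mul_one_sub_pow k (n - k)
    rw [Nat.sub_add_cancel hkn, Nat.cast_sub hkn, sub_add_cancel] at h
    simp only [mul_assoc]
    rw [intervalIntegral.integral_const_mul, intervalIntegral.integral_const_mul]
    have hn : (n + 1 : ℝ) ≠ 0 := by positivity
    field_simp
    linear_combination (n.choose k : ℝ) * h
  rw [Finset.sum_congr rfl hterm, ← Finset.sum_mul]
  have halt : ∑ k ∈ Finset.range (n + 1), (-1 : ℝ) ^ k * (n.choose k : ℝ) =
      if n = 0 then 1 else 0 := by
    exact_mod_cast Int.alternating_sum_range_choose (n := n)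
  rw [halt]
  rcases eq_or_ne n 0 with rfl | hn <;> simp [*]

end Legendre

/-! ### The uniform law on the cube -/

section Cube

variable {d : ℕ}

/-- Stated for general `S` to cover the closed and the open cube, and to reduce integrals to product
measures. -/
theorem volume_restrict_forall_mem (S : Set ℝ) :
    (volume : Measure (EuclideanSpace ℝ (Fin d))).restrict {t | ∀ i, t i ∈ S} =
      (Measure.pi fun _ : Fin d => (volume : Measure ℝ).restrict S).map (WithLp.toLp 2) := by
  have hmp := PiLp.volume_preserving_toLp (Fin d)
  have hemb : MeasurableEmbedding (WithLp.toLp 2 : (Fin d → ℝ) → EuclideanSpace ℝ (Fin d)) :=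
    (MeasurableEquiv.toLp 2 (Fin d → ℝ)).measurableEmbedding
  rw [← Measure.restrict_pi_pi, ← volume_pi, ← hmp.map_eq, hemb.restrict_map]
  congr 2
  ext t
  simp [Set.mem_pi]

theorem unif_eq_map : unif d =
    (Measure.pi fun _ : Fin d => (volume : Measure ℝ).restrict (Icc 0 1)).map (WithLp.toLp 2) :=
  volume_restrict_forall_mem _

theorem unif_eq_restrict_openUnitCube : unif d = volume.restrict (openUnitCube d) := by
  rw [unif_eq_map, openUnitCube, volume_restrict_forall_mem,
    Measure.restrict_congr_set Ioo_ae_eq_Icc]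

theorem openUnitCube_eq_iInter :
    openUnitCube d = ⋂ i, (fun t : EuclideanSpace ℝ (Fin d) => t i) ⁻¹' Ioo 0 1 := by
  ext t
  simp [openUnitCube]

theorem isOpen_openUnitCube : IsOpen (openUnitCube d) := by
  rw [openUnitCube_eq_iInter]
  exact isOpen_iInter_of_finite fun i => isOpen_Ioo.preimage (by fun_prop)

theorem nonempty_openUnitCube : (openUnitCube d).Nonempty :=
  ⟨WithLp.toLp 2 fun _ => 1 / 2, fun i => by norm_num⟩

theorem isCompact_unitCube : IsCompact (unitCube d) := by
  have h := (isCompact_univ_pi fun _ : Fin d => isCompact_Icc (a := (0 : ℝ)) (b := 1)).image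
    (PiLp.continuous_toLp 2 fun _ : Fin d => ℝ)
  convert! h
  ext t
  simp only [unitCube, mem_ofPred_eq, mem_image, mem_univ_pi]
  exact ⟨fun ht => ⟨WithLp.ofLp t, ht, rfl⟩, by rintro ⟨s, hs, rfl⟩; exact hs⟩

theorem isBounded_openUnitCube : Bornology.IsBounded (openUnitCube d) :=
  isCompact_unitCube.isBounded.subset fun _ ht i => Ioo_subset_Icc_self (ht i)

theorem integral_multiLegendre {α : Fin d → ℕ} (hα : ∀ i, 1 ≤ α i) :
    ∫ t, multiLegendre α t ∂unif d = if α = fun _ => 1 then 1 else 0 := by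
  rw [unif_eq_map, integral_map (by fun_prop)
    (continuous_multiLegendre α).aestronglyMeasurable]
  simp only [multiLegendre]
  rw [integral_fintype_prod_eq_prod (fun i => legendre (α i))]
  have h : ∀ i, ∫ t in Icc (0 : ℝ) 1, legendre (α i) t = if α i = 1 then 1 else 0 := fun i => by
    rw [integral_Icc_eq_integral_Ioc, ← intervalIntegral.integral_of_le zero_le_one,
      integral_legendre (hα i)]
  simp only [h, Finset.prod_ite_zero, Finset.prod_const_one]
  simp [funext_iff]

theorem integrable_multiLegendre (α : Fin d → ℕ) : Integrable (multiLegendre α) (unif d) :=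
  (continuous_multiLegendre α).continuousOn.integrableOn_compact isCompact_unitCube

theorem lMomentExists_of_integrable {Q : EuclideanSpace ℝ (Fin d) → EuclideanSpace ℝ (Fin d)}
    (hQ : Integrable Q (unif d)) (α : Fin d → ℕ) : LMomentExists Q α := by
  obtain ⟨C, hC⟩ := isCompact_unitCube.exists_bound_of_continuousOn
    (continuous_multiLegendre α).continuousOn
  have hmeas : MeasurableSet (unitCube d) := isCompact_unitCube.isClosed.measurableSet
  refine hQ.bdd_smul C (continuous_multiLegendre α).aestronglyMeasurable ?_
  filter_upwards [ae_restrict_mem hmeas] with t ht using hC t ht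

end Cube

/-! ### Convex potentials and affine changes -/

theorem IsConvexPotential.ae_differentiableAt {d : ℕ} {φ : EuclideanSpace ℝ (Fin d) → ℝ}
    {ν : Measure (EuclideanSpace ℝ (Fin d))} (hφ : IsConvexPotential φ ν) :
    ∀ᵐ t ∂unif d, DifferentiableAt ℝ φ t := by
  rw [unif_eq_restrict_openUnitCube]
  exact ConvexOn.ae_differentiableAt isOpen_openUnitCube hφ.1

theorem IsConvexPotential.integrable_gradient {d : ℕ} {Ω : Type*} [MeasurableSpace Ω]
    {P : Measure Ω} {X : Ω → EuclideanSpace ℝ (Fin d)} (hX : Integrable X P)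
    {φ : EuclideanSpace ℝ (Fin d) → ℝ} (hφ : IsConvexPotential φ (P.map X)) :
    Integrable (∇ φ) (unif d) := by
  have : Integrable id (P.map X) :=
    (integrable_map_measure aestronglyMeasurable_id hX.1.aemeasurable).2 hX
  rw [← hφ.2.2] at this
  exact (integrable_map_measure aestronglyMeasurable_id hφ.2.1.aemeasurable).1 this

/-- A convex potential for the law of `m + σ X`, from one for the law of `X`. -/
theorem IsConvexPotential.affine {d : ℕ} {ν : Measure (EuclideanSpace ℝ (Fin d))}
    {φ : EuclideanSpace ℝ (Fin d) → ℝ} (hφ : IsConvexPotential φ ν)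
    (m : EuclideanSpace ℝ (Fin d)) {σ : ℝ} (hσ : 0 < σ) :
    IsConvexPotential (fun t => ⟪m, t⟫ + σ * φ t) (ν.map fun x => m + σ • x) ∧
      ∇ (fun t => ⟪m, t⟫ + σ * φ t) =ᵐ[unif d] fun t => m + σ • ∇ φ t := by
  have hae : ∇ (fun t => ⟪m, t⟫ + σ * φ t) =ᵐ[unif d] fun t => m + σ • ∇ φ t := by
    filter_upwards [hφ.ae_differentiableAt] with t ht
    refine HasGradientAt.gradient (hasGradientAt_iff_hasFDerivAt.2 ?_)
    have h := (innerSL ℝ m).hasFDerivAt (x := t) |>.add (ht.hasFDerivAt.const_smul σ)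
    convert! h using 1
    ext v
    simp
  refine ⟨⟨?_, measurable_gradient _, ?_⟩, hae⟩
  · exact ((innerSL ℝ m).toLinearMap.convexOn hφ.1.1).add (hφ.1.smul hσ.le)
  · rw [Measure.map_congr hae, ← hφ.2.2, Measure.map_map (by fun_prop) hφ.2.1]
    rfl

theorem lMoment_add_smul {d : ℕ} {Q : EuclideanSpace ℝ (Fin d) → EuclideanSpace ℝ (Fin d)}
    {α : Fin d → ℕ} (hα : ∀ i, 1 ≤ α i) (hQ : LMomentExists Q α)
    (m : EuclideanSpace ℝ (Fin d)) (σ : ℝ) :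
    lMoment (fun t => m + σ • Q t) α =
      σ • lMoment Q α + (if α = fun _ => 1 then m else 0) := by
  have hcongr : (fun t => multiLegendre α t • (m + σ • Q t)) =
      fun t => σ • (multiLegendre α t • Q t) + multiLegendre α t • m := by
    funext t
    rw [smul_add, smul_comm, add_comm]
  simp only [lMoment]
  have hadd : ∫ t, σ • (multiLegendre α t • Q t) + multiLegendre α t • m ∂unif d =
      ∫ t, σ • (multiLegendre α t • Q t) ∂unif d + ∫ t, multiLegendre α t • m ∂unif d :=
    integral_add (hQ.smul σ) ((integrable_multiLegendre α).smul_const m)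
  rw [hcongr, hadd, integral_smul, integral_smul_const, integral_multiLegendre hα]
  split_ifs <;> simp

end MultivariateLMoments

theorem mainTheorem10 {d : ℕ} {Ω : Type*} [MeasurableSpace Ω]
    (P : Measure Ω) [IsProbabilityMeasure P]
    (X : Ω → EuclideanSpace ℝ (Fin d)) (hX : Integrable X P)
    (φ : EuclideanSpace ℝ (Fin d) → ℝ)
    (hφ : MultivariateLMoments.IsConvexPotential φ (P.map X))
    (m : EuclideanSpace ℝ (Fin d)) (σ : ℝ) (hσ : 0 < σ)
    (α : Fin d → ℕ) (hα : ∀ i, 1 ≤ α i) :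
    MultivariateLMoments.LMomentExists (∇ φ) α ∧
    (∃ ψ, MultivariateLMoments.IsConvexPotential ψ (P.map (fun ω => m + σ • X ω))) ∧
    ∀ ψ, MultivariateLMoments.IsConvexPotential ψ (P.map (fun ω => m + σ • X ω)) →
      MultivariateLMoments.LMomentExists (∇ ψ) α ∧
      MultivariateLMoments.lMoment (∇ ψ) α =
        σ • MultivariateLMoments.lMoment (∇ φ) α + (if α = fun _ => 1 then m else 0) := by
  have hgφ := MultivariateLMoments.IsConvexPotential.integrable_gradient hX hφ
  have hLφ := MultivariateLMoments.lMomentExists_of_integrable hgφ α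
  have hlaw : P.map (fun ω => m + σ • X ω) = (P.map X).map fun x => m + σ • x :=
    (AEMeasurable.map_map_of_aemeasurable (g := fun x => m + σ • x) (by fun_prop)
      hX.1.aemeasurable).symm
  have hY : Integrable (fun ω => m + σ • X ω) P := (integrable_const m).add (hX.smul σ)
  obtain ⟨hψ₀, hae⟩ := hφ.affine m hσ
  rw [← hlaw] at hψ₀
  refine ⟨hLφ, ⟨_, hψ₀⟩, fun ψ hψ => ?_⟩
  have hgψ := MultivariateLMoments.IsConvexPotential.integrable_gradient hY hψ
  have hgψ₀ := MultivariateLMoments.IsConvexPotential.integrable_gradient hY hψ₀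
  refine ⟨MultivariateLMoments.lMomentExists_of_integrable hgψ α, ?_⟩
  have huniq : ∇ ψ =ᵐ[MultivariateLMoments.unif d] fun t => m + σ • ∇ φ t := by
    refine Filter.EventuallyEq.trans ?_ hae
    have hmap := hψ.2.2.trans hψ₀.2.2.symm
    rw [MultivariateLMoments.unif_eq_restrict_openUnitCube] at hmap hgψ hgψ₀ ⊢
    exact MultivariateLMoments.gradient_ae_eq_of_map_eq
      MultivariateLMoments.isOpen_openUnitCube MultivariateLMoments.nonempty_openUnitCube
      MultivariateLMoments.isBounded_openUnitCube hψ.1 hψ₀.1 hgψ hgψ₀ hmap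
  rw [← MultivariateLMoments.lMoment_add_smul hα hLφ]
  exact integral_congr_ae (huniq.mono fun t ht => by simp only [ht])
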